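/- Let $k$ be an algebraically closed field of arbitrary characteristic, let $n$ be a natural number, and let $f\in k[x_1,\dots,x_n]$ be a nonzero polynomial. Let $w=(w(x_1),\dots,w(x_n))\in(\mathbb{Z}_{\ge 0})^n\setminus\{0\}$ be a weight, and let $w(f)$ be the weighted multiplicity of $f$, i.e. the lowest weight $\sum_i m_i w(x_i)$ of the monomials $x_1^{m_1}\cdots x_n^{m_n}$ occurring in $f$ with nonzero coefficient. Then $$\frac{1}{\operatorname{lct}_0(\mathbb{A}^n_k,\operatorname{div}(f))}\ \ge\ \frac{w(f)}{\sum_{i=1}^n w(x_i)} .$$ Here $\operatorname{lct}_0(\mathbb{A}^n_k,\operatorname{div}(f))\in[0,\infty]$ is the log canonical threshold at the origin, that is, the supremum of all real $c\ge 0$ such that for some open neighbourhood $U$ of $0$ the pair $(U,c\cdot\operatorname{div}(f)|_U)$ is log canonical: for every birational morphism $\pi:Y\to U$ from a normal variety $Y$ over $k$ and every prime divisor $E\subset Y$, the discrepancy $a$ of $E$, defined by $K_Y=\pi^*(K_U+c\cdot\operatorname{div}(f))+aE$ near the generic point of $E$, satisfies $a\ge -1$. The conventions $1/\infty=0$ and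 $1/0=\infty$ are used. -/

import Mathlib

open CategoryTheory AlgebraicGeometry
open scoped ENNReal NNReal KaehlerDifferential

universe u

noncomputable section

namespace LogCanonical

/-- A normal variety over a field `k` (with structure morphism `s`): an integral separated scheme
of finite type over `k`, all of whose local rings are integrally closed. -/
structure IsNormalVariety (k : Type u) [Field k] {Y : Scheme.{u}}
    (s : Y ⟶ Spec (CommRingCat.of k)) : Prop where
  isIntegral : AlgebraicGeometry.IsIntegral Y
  isSeparated : IsSeparated s
  locallyOfFiniteType : LocallyOfFiniteType s
  quasiCompact : QuasiCompact s
  isIntegrallyClosed : ∀ y : Y, IsIntegrallyClosed (Y.presheaf.stalk y)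

/-- A prime divisor over a scheme `X` over a field `k`: a birational morphism `π : Y ⟶ X` from a
normal variety `Y` over `k`, together with a prime divisor `E ⊆ Y`, represented by its generic
point (a point of codimension one of `Y`). -/
structure PrimeDivisorOver (k : Type u) [Field k] {X : Scheme.{u}}
    (s : X ⟶ Spec (CommRingCat.of k)) where
  /-- the model on which the divisor lives -/
  Y : Scheme.{u}
  /-- the morphism to the base -/
  π : Y ⟶ X
  isNormalVariety : IsNormalVariety k (π ≫ s)
  /-- `π` restricts to an isomorphism between dense open subschemes of `Y` and of `X` -/
  birational : Scheme.BirationalOver π (𝟙 X)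
  /-- the generic point of the divisor `E` -/
  genericPoint : Y
  codim_one : Order.coheight genericPoint = 1

/-- Affine `n`-space over `k`. -/
abbrev affineSpace (k : Type u) [Field k] (n : ℕ) : Scheme.{u} :=
  Spec (CommRingCat.of (MvPolynomial (Fin n) k))

/-- The structure morphism of affine `n`-space over `k`. -/
def affineSpaceToBase (k : Type u) [Field k] (n : ℕ) :
    affineSpace k n ⟶ Spec (CommRingCat.of k) :=
  Spec.map (CommRingCat.ofHom MvPolynomial.C)

/-- The origin of affine `n`-space: the maximal ideal of polynomials vanishing at `0`. -/
def origin (k : Type u) [Field k] (n : ℕ) : affineSpace k n :=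
  (⟨RingHom.ker (MvPolynomial.constantCoeff : MvPolynomial (Fin n) k →+* k),
    RingHom.ker_isPrime _⟩ : PrimeSpectrum (MvPolynomial (Fin n) k))

/-- Pull-back of functions along `g : Y ⟶ Spec R`, followed by passing to germs at `y`. -/
def pullbackGerm {R : CommRingCat.{u}} {Y : Scheme.{u}} (g : Y ⟶ Spec R) (y : Y) :
    R →+* Y.presheaf.stalk y :=
  ((Scheme.ΓSpecIso R).inv ≫ g.appTop ≫ Y.presheaf.germ ⊤ y trivial).hom

/-- The order of vanishing of an element `s` of a module `M` over a local ring `(R, 𝔪)`, that is,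
the supremum of all `m` with `s ∈ 𝔪 ^ m M`. If `R` is a discrete valuation ring and `M` is free of
rank one with basis `e`, then the order of `r • e` is the normalized valuation of `r`. -/
def vanishingOrder (R : Type u) [CommRing R] [IsLocalRing R] {M : Type u} [AddCommGroup M]
    [Module R M] (s : M) : ℕ∞ :=
  ⨆ (m : ℕ) (_ : s ∈ (IsLocalRing.maximalIdeal R ^ m) • (⊤ : Submodule R M)), (m : ℕ∞)

/-- For a ring homomorphism `φ` from `k[x₁, …, xₙ]` to a local ring `R`, the order of vanishing of
the pulled back volume form `dφ(x₁) ∧ ⋯ ∧ dφ(xₙ)` as an element of `⋀ⁿ Ω_{R/k}`. -/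
def volumeFormOrder {k : Type u} [Field k] {n : ℕ} {R : Type u} [CommRing R] [IsLocalRing R]
    (φ : MvPolynomial (Fin n) k →+* R) : ℕ∞ :=
  letI : Algebra k R := (φ.comp MvPolynomial.C).toAlgebra
  vanishingOrder R
    (exteriorPower.ιMulti R n fun i => KaehlerDifferential.D k R (φ (MvPolynomial.X i)))

section Pairs

variable {k : Type u} [Field k] {n : ℕ}

/-- The discrepancy `a(E; U, c · div f)` of a prime divisor `E` over an open subscheme `U` of
affine `n`-space over a perfect field `k`, for `f ≠ 0`.
The form `ω = dx₁ ∧ ⋯ ∧ dxₙ` is a nowhere vanishing section of the canonical sheaf of `U`, so that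
`K_U = div ω = 0`. On `Y`, the canonical sheaf is `⋀ⁿ Ω_{Y/k}` near the generic point of `E`, and
`K_Y = div (π^* ω)`. Thus `K_Y = π^* (K_U + c · div f) + a E` near the generic point of `E` means
`a = ord_E (π^* ω) - c · ord_E (π^* f)`. Both orders are finite, since `π` is birational. -/
def discrepancy (U : (affineSpace k n).Opens) (f : MvPolynomial (Fin n) k) (c : ℝ≥0)
    (E : PrimeDivisorOver k (U.ι ≫ affineSpaceToBase k n)) : ℝ :=
  ((volumeFormOrder (pullbackGerm (E.π ≫ U.ι) E.genericPoint)).toNat : ℝ) -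
    c * ((vanishingOrder (E.Y.presheaf.stalk E.genericPoint)
      (pullbackGerm (E.π ≫ U.ι) E.genericPoint f)).toNat : ℝ)

/-- The pair `(U, c · div f)` is log canonical: all discrepancies are at least `-1`. -/
def IsLogCanonical (U : (affineSpace k n).Opens) (f : MvPolynomial (Fin n) k) (c : ℝ≥0) : Prop :=
  ∀ E : PrimeDivisorOver k (U.ι ≫ affineSpaceToBase k n), -1 ≤ discrepancy U f c E

/-- The pair `(𝔸ⁿ, c · div f)` is log canonical at the point `x`: its restriction to some open
neighbourhood of `x` is log canonical. -/
def IsLogCanonicalAt (x : affineSpace k n) (f : MvPolynomial (Fin n) k) (c : ℝ≥0) : Prop :=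
  ∃ U : (affineSpace k n).Opens, x ∈ U ∧ IsLogCanonical U f c

/-- The log canonical threshold `lct_x(𝔸ⁿ, div f)` at the point `x`, for `f ≠ 0`; it is `∞` if
`f` does not vanish at `x`. -/
def lctAt (x : affineSpace k n) (f : MvPolynomial (Fin n) k) : ℝ≥0∞ :=
  ⨆ (c : ℝ≥0) (_ : IsLogCanonicalAt x f c), (c : ℝ≥0∞)

/-- The weighted multiplicity `w(f)` of `f ≠ 0`: the lowest weight `∑ i, mᵢ w(xᵢ)` of the
monomials `x ^ m` occurring in `f`. -/
def weightedMultiplicity (w : Fin n → ℕ) (f : MvPolynomial (Fin n) k) : ℕ :=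
  sInf {d | ∃ m ∈ f.support, d = ∑ i, m i * w i}

end Pairs

end LogCanonical

end

/-! ### Completing a weight vector to a unimodular matrix -/

noncomputable section

namespace LogCanonical

/-! One divisor over the origin suffices, that of the weighted blow-up. Instead of constructing the
blow-up, write `w` as `g` times row `i` of a nonnegative integer matrix `B` of determinant 1
(`exists_unimodular_row`). The substitution `x_j ↦ ∏ l, x_l ^ B l j` is an automorphism of the
torus, hence a birational morphism from affine space to itself, and it fixes the origin; over any
neighbourhood `U` of the origin the hyperplane `x_i = 0` therefore gives a prime divisor `E`
(`toricDivisor`).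

Since `x_j` has order `B i j` along `E`, the order of `f` is at least `d = w(f) / g`. The Jacobian
determinant is `det B` times a monomial of `x_i`-degree `∑ j, B i j - 1`; as `det B = 1`, it is
nonzero in every characteristic. Hence the volume form has order less than `∑ j, B i j`. Discrepancy
at least `-1` then gives `c * d ≤ ∑ j, B i j`, and multiplying by `g` gives `c * w(f) ≤ ∑ j, w j`.
-/

/-- A nonzero vector of natural numbers is a multiple of a row of a unimodular matrix with
nonnegative entries. -/
theorem exists_unimodular_row {n : ℕ} (w : Fin n → ℕ) (hw : w ≠ 0) :
    ∃ (B : Matrix (Fin n) (Fin n) ℕ) (i : Fin n) (g : ℕ),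
      (B.map (Nat.cast : ℕ → ℤ)).det = 1 ∧ 0 < g ∧ ∀ j, g * B i j = w j := by
  induction h : ∑ i, w i using Nat.strong_induction_on generalizing w with
  | _ s ih =>
  obtain ⟨i, hi⟩ := Function.ne_iff.mp hw
  have hi : 0 < w i := Nat.pos_of_ne_zero hi
  by_cases hall : ∀ j, j ≠ i → w j = 0
  · refine ⟨1, i, w i, by simp, hi, fun j => ?_⟩
    rcases eq_or_ne j i with rfl | hj
    · simp
    · simp [Matrix.one_apply_ne hj.symm, hall j hj]
  · push Not at hall
    obtain ⟨j, hji, hj⟩ := hall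
    have hj : 0 < w j := Nat.pos_of_ne_zero hj
    -- Subtractive Euclidean algorithm: replacing `w b` by `w b - w a` keeps the vector nonzero,
    -- because `w a` survives, and lowers the sum.
    obtain ⟨a, b, hab, ha, hle⟩ : ∃ a b, a ≠ b ∧ 0 < w a ∧ w a ≤ w b := by
      rcases le_total (w i) (w j) with hle | hle
      · exact ⟨i, j, hji.symm, hi, hle⟩
      · exact ⟨j, i, hji, hj, hle⟩
    obtain ⟨B, r, g, hdet, hg, hB⟩ := ih (∑ i, Function.update w b (w b - w a) i) (by
      rw [← h]
      refine Finset.sum_lt_sum (fun l _ => ?_) ⟨b, Finset.mem_univ _, by simp; omega⟩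
      rcases eq_or_ne l b with rfl | hl <;> simp [*])
      (Function.update w b (w b - w a))
      (Function.ne_iff.mpr ⟨a, by simpa [Function.update_of_ne hab] using ha.ne'⟩) rfl
    -- Adding column `a` to column `b` undoes the subtraction and preserves the determinant and
    -- nonnegativity.
    refine ⟨Matrix.of fun p q => B p q + if q = b then B p a else 0, r, g, ?_, hg, fun l => ?_⟩
    · have : (Matrix.of fun p q => B p q + if q = b then B p a else 0).map (Nat.cast : ℕ → ℤ) =
          B.map (Nat.cast : ℕ → ℤ) * Matrix.transvection a b 1 := by
        ext p q
        rcases eq_or_ne q b with rfl | hq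
        · simp
        · simp [hq]
      rw [this, Matrix.det_mul, Matrix.det_transvection_of_ne _ _ hab, hdet, one_mul]
    · rcases eq_or_ne l b with rfl | hl
      · simp [mul_add, hB, Function.update_of_ne hab]
        omega
      · simp [hl, hB]

/-! ### Monomial substitutions and Laurent polynomials -/

section MonomialMap

variable (k : Type u) [Field k] {n : ℕ} (B : Matrix (Fin n) (Fin n) ℕ)

/-- The endomorphism of `k[x₁, …, xₙ]` that sends `x_j` to `∏ i, x_i ^ B i j`. -/
def monomialMap : MvPolynomial (Fin n) k →ₐ[k] MvPolynomial (Fin n) k :=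
  MvPolynomial.aeval fun j => ∏ i, MvPolynomial.X i ^ B i j

/-- The ring of Laurent polynomials in `n` variables. -/
abbrev LaurentRing (n : ℕ) : Type u :=
  Localization.Away (∏ i, MvPolynomial.X i : MvPolynomial (Fin n) k)

theorem algebraMap_laurentRing_injective :
    Function.Injective (algebraMap (MvPolynomial (Fin n) k) (LaurentRing k n)) :=
  IsLocalization.injective (M := Submonoid.powers (∏ i, MvPolynomial.X i)) _
    (powers_le_nonZeroDivisors_of_noZeroDivisors
      (Finset.prod_ne_zero_iff.mpr fun i _ => MvPolynomial.X_ne_zero i))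

/-- The variable `x_i` as a unit of the Laurent polynomial ring. -/
def laurentVar (i : Fin n) : (LaurentRing k n)ˣ :=
  (isUnit_of_dvd_unit
    (map_dvd (algebraMap (MvPolynomial (Fin n) k) (LaurentRing k n))
      (Finset.dvd_prod_of_mem (fun i => (MvPolynomial.X i : MvPolynomial (Fin n) k))
        (Finset.mem_univ i)))
    (IsLocalization.Away.algebraMap_isUnit _)).unit

@[simp]
theorem laurentVar_val (i : Fin n) : (laurentVar k i : LaurentRing k n) =
    algebraMap (MvPolynomial (Fin n) k) (LaurentRing k n) (MvPolynomial.X i) := rfl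

/-- The homomorphism from polynomials to Laurent polynomials given by an integer matrix. -/
def laurentAux (A : Matrix (Fin n) (Fin n) ℤ) : MvPolynomial (Fin n) k →ₐ[k] LaurentRing k n :=
  MvPolynomial.aeval fun j => ((∏ i, laurentVar k i ^ A i j : (LaurentRing k n)ˣ) : LaurentRing k n)

/-- The endomorphism of the Laurent polynomial ring given by an integer matrix. -/
def laurentMap (A : Matrix (Fin n) (Fin n) ℤ) : LaurentRing k n →ₐ[k] LaurentRing k n :=
  IsLocalization.liftAlgHom (M := Submonoid.powers (∏ i, MvPolynomial.X i : MvPolynomial (Fin n) k))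
    (f := laurentAux k A) (by
      rintro ⟨_, m, rfl⟩
      rw [map_pow, map_prod]
      refine IsUnit.pow _ (IsUnit.prod_univ_iff.mpr fun j => ?_)
      simp only [laurentAux, MvPolynomial.aeval_X]
      exact Units.isUnit _)

theorem laurentMap_algebraMap (A : Matrix (Fin n) (Fin n) ℤ) (p : MvPolynomial (Fin n) k) :
    laurentMap k A (algebraMap _ _ p) = laurentAux k A p := by
  simp [laurentMap]

theorem laurentMap_var (A : Matrix (Fin n) (Fin n) ℤ) (j : Fin n) :
    Units.map (laurentMap k A : LaurentRing k n →* LaurentRing k n) (laurentVar k j) =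
      ∏ i, laurentVar k i ^ A i j := by
  ext
  simp [laurentMap_algebraMap, laurentAux]

/-- In the unit group, composing substitutions multiplies their exponent matrices. -/
theorem laurentMap_comp (A C : Matrix (Fin n) (Fin n) ℤ) (h : C * A = 1) :
    (laurentMap k C).comp (laurentMap k A) = AlgHom.id k _ := by
  refine IsLocalization.algHom_ext
    (Submonoid.powers (∏ i, MvPolynomial.X i : MvPolynomial (Fin n) k)) ?_
  refine MvPolynomial.algHom_ext fun j => ?_
  have : Units.map (laurentMap k C : LaurentRing k n →* LaurentRing k n)
      (Units.map (laurentMap k A : LaurentRing k n →* LaurentRing k n) (laurentVar k j)) =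
      laurentVar k j := by
    rw [laurentMap_var, map_prod]
    simp_rw [map_zpow, laurentMap_var, ← Finset.prod_zpow, ← zpow_mul]
    rw [Finset.prod_comm]
    have hexp (l : Fin n) : ∏ i, laurentVar k l ^ (C l i * A i j) =
        laurentVar k l ^ (1 : Matrix (Fin n) (Fin n) ℤ) l j := by
      rw [← h, Matrix.mul_apply]
      exact (map_sum (zpowersHom _ (laurentVar k l)).toAdditive _ _).symm
    simp_rw [hexp]
    refine (Fintype.prod_eq_single j fun l hl => ?_).trans ?_
    · rw [Matrix.one_apply_ne hl, zpow_zero]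
    · rw [Matrix.one_apply_eq, zpow_one]
  exact congrArg Units.val this

theorem algebraMap_monomialMap (p : MvPolynomial (Fin n) k) :
    algebraMap _ (LaurentRing k n) (monomialMap k B p) =
      laurentMap k (B.map (Nat.cast : ℕ → ℤ)) (algebraMap _ _ p) := by
  rw [laurentMap_algebraMap]
  suffices (Algebra.algHom k (MvPolynomial (Fin n) k) (LaurentRing k n)).comp (monomialMap k B) =
      laurentAux k (B.map (Nat.cast : ℕ → ℤ)) from DFunLike.congr_fun this p
  refine MvPolynomial.algHom_ext fun j => ?_
  simp [monomialMap, laurentAux]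
  rfl

variable {B}

/-- A unimodular matrix defines an automorphism of the Laurent polynomial ring. -/
def laurentEquiv (h : (B.map (Nat.cast : ℕ → ℤ)).det = 1) : LaurentRing k n ≃ₐ[k] LaurentRing k n :=
  AlgEquiv.ofAlgHom (laurentMap k (B.map (Nat.cast : ℕ → ℤ)))
    (laurentMap k (B.map (Nat.cast : ℕ → ℤ)).adjugate)
    (laurentMap_comp k _ _ (by rw [Matrix.mul_adjugate, h, one_smul]))
    (laurentMap_comp k _ _ (by rw [Matrix.adjugate_mul, h, one_smul]))

theorem algebraMap_comp_monomialMap (h : (B.map (Nat.cast : ℕ → ℤ)).det = 1) :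
    (algebraMap _ (LaurentRing k n)).comp (monomialMap k B).toRingHom =
      (laurentEquiv k h).toRingEquiv.toRingHom.comp (algebraMap _ _) :=
  RingHom.ext (algebraMap_monomialMap k B)

theorem monomialMap_injective (h : (B.map (Nat.cast : ℕ → ℤ)).det = 1) :
    Function.Injective (monomialMap k B) := by
  refine Function.Injective.of_comp (f := algebraMap _ (LaurentRing k n)) ?_
  have := (laurentEquiv k h).injective.comp (algebraMap_laurentRing_injective k)
  convert this using 1
  exact funext (algebraMap_monomialMap k B)

/-- A matrix of determinant 1 has no zero column, so every variable goes to a nonconstant monomial: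
the toric morphism fixes the origin. -/
theorem constantCoeff_monomialMap (h : (B.map (Nat.cast : ℕ → ℤ)).det = 1)
    (p : MvPolynomial (Fin n) k) :
    MvPolynomial.constantCoeff (monomialMap k B p) = MvPolynomial.constantCoeff p := by
  suffices (MvPolynomial.constantCoeff.comp (monomialMap k B).toRingHom) =
      (MvPolynomial.constantCoeff : MvPolynomial (Fin n) k →+* k) from RingHom.congr_fun this p
  refine MvPolynomial.ringHom_ext (by simp) fun j => ?_
  have : ∃ i, B i j ≠ 0 := by
    by_contra! h0
    have := Matrix.det_eq_zero_of_column_eq_zero (A := B.map (Nat.cast : ℕ → ℤ)) j (by simp [h0])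
    omega
  obtain ⟨i, hi⟩ := this
  simp only [monomialMap, AlgHom.toRingHom_eq_coe, RingHom.coe_comp, RingHom.coe_coe,
    Function.comp_apply, MvPolynomial.aeval_X, map_prod, map_pow, MvPolynomial.constantCoeff_X]
  exact Finset.prod_eq_zero (Finset.mem_univ i) (zero_pow hi)

end MonomialMap

end LogCanonical

end

noncomputable section

namespace LogCanonical

/-! ### Bounds for vanishing orders -/

section VanishingOrder

variable {R : Type u} [CommRing R] [IsLocalRing R] {M : Type u} [AddCommGroup M] [Module R M]

theorem le_vanishingOrder {s : M} {d : ℕ}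
    (h : s ∈ (IsLocalRing.maximalIdeal R ^ d) • (⊤ : Submodule R M)) :
    (d : ℕ∞) ≤ vanishingOrder R s :=
  le_iSup₂_of_le d h le_rfl

theorem vanishingOrder_lt {s : M} {N : ℕ}
    (h : s ∉ (IsLocalRing.maximalIdeal R ^ N) • (⊤ : Submodule R M)) :
    vanishingOrder R s < N := by
  obtain _ | N := N
  · simp at h
  · rw [Nat.cast_succ, ENat.lt_natCast_add_one_iff]
    refine iSup₂_le fun m hm => ?_
    by_contra! hlt
    exact h (Submodule.smul_mono_left (Ideal.pow_le_pow_right (by exact_mod_cast hlt)) hm)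

theorem vanishingOrder_toNat_lt {s : M} {N : ℕ}
    (h : s ∉ (IsLocalRing.maximalIdeal R ^ N) • (⊤ : Submodule R M)) :
    (vanishingOrder R s).toNat < N := by
  have := vanishingOrder_lt h
  rw [← ENat.natCast_toNat (this.trans (ENat.natCast_lt_top N)).ne] at this
  exact_mod_cast this

/-- Krull's intersection theorem makes the order finite; an infinite order would become `0` under
`toNat` and break the lower bound. -/
theorem le_vanishingOrder_toNat [IsNoetherianRing R] {r : R} {d : ℕ} (hr : r ≠ 0)
    (h : r ∈ IsLocalRing.maximalIdeal R ^ d) :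
    d ≤ (vanishingOrder R r).toNat := by
  have hbot := Ideal.iInf_pow_eq_bot_of_isLocalRing _ (IsLocalRing.maximalIdeal.isMaximal R).ne_top
  obtain ⟨N, hN⟩ : ∃ N, r ∉ IsLocalRing.maximalIdeal R ^ N := by
    by_contra! hall
    exact hr (by simpa [hbot] using Ideal.mem_iInf.mpr hall)
  have htop : vanishingOrder R r ≠ ⊤ :=
    ((vanishingOrder_lt (N := N) (by simpa using hN)).trans (ENat.natCast_lt_top N)).ne
  have := le_vanishingOrder (R := R) (s := r) (d := d) (by simpa using h)
  rw [← ENat.natCast_toNat htop] at this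
  exact_mod_cast this

end VanishingOrder

/-! ### Orders of functions and of the volume form along a coordinate hyperplane -/

section LocalComputation

open MvPolynomial

variable {k : Type u} [Field k] {n : ℕ}

instance isPrime_span_X (i : Fin n) : (Ideal.span {(X i : MvPolynomial (Fin n) k)}).IsPrime :=
  (Ideal.span_singleton_prime (X_ne_zero i)).mpr X_prime

variable {R : Type u} [CommRing R] [Algebra (MvPolynomial (Fin n) k) R]

theorem monomialMap_mem_pow (B : Matrix (Fin n) (Fin n) ℕ) (i : Fin n) (d : ℕ)
    (f : MvPolynomial (Fin n) k) (hd : ∀ m ∈ f.support, d ≤ ∑ j, m j * B i j) :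
    monomialMap k B f ∈ Ideal.span {(X i : MvPolynomial (Fin n) k)} ^ d := by
  rw [Ideal.span_singleton_pow, Ideal.mem_span_singleton, monomialMap, aeval_def, eval₂_eq']
  refine Finset.dvd_sum fun m hm => Dvd.dvd.mul_left ?_ _
  simp_rw [← Finset.prod_pow, ← pow_mul]
  rw [Finset.prod_comm]
  refine Dvd.dvd.trans ?_ (Finset.dvd_prod_of_mem _ (Finset.mem_univ i))
  rw [Finset.prod_pow_eq_pow_sum]
  exact pow_dvd_pow _ ((hd m hm).trans (Finset.sum_le_sum fun j _ => (mul_comm _ _).le))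

theorem le_vanishingOrder_monomialMap [IsLocalRing R] (B : Matrix (Fin n) (Fin n) ℕ)
    (hB : (B.map (Nat.cast : ℕ → ℤ)).det = 1) (i : Fin n)
    [IsLocalization.AtPrime R (Ideal.span {(X i : MvPolynomial (Fin n) k)})] (d : ℕ)
    (f : MvPolynomial (Fin n) k) (hf : f ≠ 0) (hd : ∀ m ∈ f.support, d ≤ ∑ j, m j * B i j) :
    d ≤ (vanishingOrder R (algebraMap _ R (monomialMap k B f))).toNat := by
  set P : Ideal (MvPolynomial (Fin n) k) := Ideal.span {X i}
  have := IsLocalization.isNoetherianRing P.primeCompl R inferInstance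
  refine le_vanishingOrder_toNat ?_ ?_
  · have hinj := IsLocalization.injective R P.primeCompl_le_nonZeroDivisors
    exact (map_ne_zero_iff _ hinj).mpr
      ((map_ne_zero_iff _ (monomialMap_injective k hB)).mpr hf)
  · rw [← IsLocalization.AtPrime.map_eq_maximalIdeal P R, ← Ideal.map_pow]
    exact Ideal.mem_map_of_mem _ (monomialMap_mem_pow B i d f hd)

variable [Algebra k R] [IsScalarTower k (MvPolynomial (Fin n) k) R]

/-- The partial derivative with respect to `x_i`, as a linear form on the differentials of a
localization of the polynomial ring. -/
def partialForm (M : Submonoid (MvPolynomial (Fin n) k)) [IsLocalization M R] (i : Fin n) :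
    Ω[R⁄k] →ₗ[R] R :=
  haveI := Algebra.FormallyEtale.of_isLocalization (Rₘ := R) M
  (LinearMap.liftBaseChange R
    ((Algebra.linearMap (MvPolynomial (Fin n) k) R).comp
      (pderiv (R := k) i).liftKaehlerDifferential)).comp
    (KaehlerDifferential.tensorKaehlerEquivOfFormallyEtale k
      (MvPolynomial (Fin n) k) R).symm.toLinearMap

theorem partialForm_D (M : Submonoid (MvPolynomial (Fin n) k)) [IsLocalization M R] (i : Fin n)
    (p : MvPolynomial (Fin n) k) :
    partialForm M i (KaehlerDifferential.D k R (algebraMap _ R p)) =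
      algebraMap _ R (pderiv i p) := by
  have := Algebra.FormallyEtale.of_isLocalization (Rₘ := R) M
  simp only [partialForm, LinearMap.comp_apply, LinearEquiv.coe_coe]
  rw [KaehlerDifferential.tensorKaehlerEquivOfFormallyEtale_symm_D_algebraMap]
  simp

/-- If the top form `dp₁ ∧ ⋯ ∧ dpₙ` vanishes modulo `I`, then so does the Jacobian determinant. -/
theorem det_pderiv_mem_of_ιMulti_mem (M : Submonoid (MvPolynomial (Fin n) k)) [IsLocalization M R]
    (p : Fin n → MvPolynomial (Fin n) k) (I : Ideal R)
    (h : exteriorPower.ιMulti R n (fun j => KaehlerDifferential.D k R (algebraMap _ R (p j))) ∈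
      I • (⊤ : Submodule R (⋀[R]^n Ω[R⁄k]))) :
    algebraMap _ R (Matrix.of fun i j => pderiv i (p j)).det ∈ I := by
  -- The determinant of the partial derivatives is a linear form on top forms, so it sends `I • ⊤`
  -- into `I`; no freeness of the differentials is needed.
  let ℓ : ⋀[R]^n Ω[R⁄k] →ₗ[R] R := exteriorPower.alternatingMapLinearEquiv
    (Matrix.detRowAlternating.compLinearMap (LinearMap.pi fun i => partialForm M i))
  have hℓ : ℓ (exteriorPower.ιMulti R n
      (fun j => KaehlerDifferential.D k R (algebraMap _ R (p j)))) =
      algebraMap _ R (Matrix.of fun i j => pderiv i (p j)).det := by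
    rw [exteriorPower.alternatingMapLinearEquiv_apply_ιMulti, ← Matrix.det_transpose,
      RingHom.map_det]
    refine congrArg Matrix.det (Matrix.ext fun i j => ?_)
    simp [partialForm_D]
  rw [← hℓ]
  have := Submodule.mem_map_of_mem (f := ℓ) h
  rw [Submodule.map_smul''] at this
  exact (Ideal.mul_le_left (J := Submodule.map ℓ ⊤)) this

/-- The Jacobian determinant of a monomial map. -/
theorem prod_X_mul_det_pderiv (B : Matrix (Fin n) (Fin n) ℕ) :
    (∏ i, X i) * (Matrix.of fun i j => pderiv i (monomialMap k B (X j))).det =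
      ((B.map (Nat.cast : ℕ → ℤ)).det : MvPolynomial (Fin n) k) *
        ∏ j, monomialMap k B (X j) := by
  -- Entrywise this is `x_i * ∂_i m = B i j * m` for the monomial `m` that is the image of `x_j`;
  -- the factor `x_i` avoids negative exponents.
  have hmat : Matrix.diagonal (fun i => (X i : MvPolynomial (Fin n) k)) *
      (Matrix.of fun i j => pderiv i (monomialMap k B (X j))) =
      (B.map (Nat.cast : ℕ → ℤ)).map (Int.castRingHom (MvPolynomial (Fin n) k)) *
        Matrix.diagonal (fun j => monomialMap k B (X j)) := by
    ext1 i j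
    simp only [Matrix.diagonal_mul, Matrix.mul_diagonal, Matrix.of_apply, Matrix.map_apply]
    simp only [monomialMap, aeval_X]
    rw [← Finset.mul_prod_erase _ _ (Finset.mem_univ i), Derivation.leibniz]
    have : pderiv i (∏ l ∈ Finset.univ.erase i, (X l : MvPolynomial (Fin n) k) ^ B l j) = 0 := by
      refine pderiv_eq_zero_of_notMem_vars fun hmem => ?_
      obtain ⟨l, hl, hl'⟩ := Finset.mem_biUnion.mp (vars_prod _ hmem)
      have := vars_pow _ _ hl'
      simp at this
      simp [this] at hl
    rw [this, pderiv_pow, pderiv_X_self]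
    rcases Nat.eq_zero_or_pos (B i j) with h0 | hpos
    · simp [h0]
    · obtain ⟨b, hb⟩ := Nat.exists_eq_succ_of_ne_zero hpos.ne'
      simp [hb]
      ring
  have := congrArg Matrix.det hmat
  rw [Matrix.det_mul, Matrix.det_mul, Matrix.det_diagonal, Matrix.det_diagonal] at this
  rw [this]
  congr 1
  exact ((Int.castRingHom (MvPolynomial (Fin n) k)).map_det _).symm

theorem prod_monomialMap_X (B : Matrix (Fin n) (Fin n) ℕ) (i : Fin n) :
    ∏ j, monomialMap k B (X j) =
      X i ^ (∑ j, B i j) * ∏ l ∈ Finset.univ.erase i, X l ^ (∑ j, B l j) := by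
  simp only [monomialMap, aeval_X]
  rw [Finset.prod_comm, ← Finset.mul_prod_erase _ _ (Finset.mem_univ i)]
  simp_rw [Finset.prod_pow_eq_pow_sum]

/-- With `N = ∑ j, B i j`, a form in `𝔪 ^ N` would put the Jacobian in `𝔪 ^ N`, and its product with
all variables in `𝔪 ^ (N + 1)`. That product is `x_i ^ N` times a unit, since the other variables
are invertible at the generic point of `x_i = 0`. -/
theorem ιMulti_monomialMap_notMem [IsLocalRing R] (B : Matrix (Fin n) (Fin n) ℕ)
    (hB : (B.map (Nat.cast : ℕ → ℤ)).det = 1) (i : Fin n)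
    [IsLocalization.AtPrime R (Ideal.span {(X i : MvPolynomial (Fin n) k)})] :
    exteriorPower.ιMulti R n
        (fun j => KaehlerDifferential.D k R (algebraMap _ R (monomialMap k B (X j)))) ∉
      (IsLocalRing.maximalIdeal R ^ ∑ j, B i j) • (⊤ : Submodule R (⋀[R]^n Ω[R⁄k])) := by
  intro h
  replace h := det_pderiv_mem_of_ιMulti_mem
    (Ideal.span {(X i : MvPolynomial (Fin n) k)}).primeCompl _ _ h
  set N := ∑ j, B i j with hN
  set P : Ideal (MvPolynomial (Fin n) k) := Ideal.span {X i}
  have hmax := IsLocalization.AtPrime.map_eq_maximalIdeal P R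
  have hX : algebraMap _ R (X i : MvPolynomial (Fin n) k) ∈ IsLocalRing.maximalIdeal R :=
    hmax ▸ Ideal.mem_map_of_mem _ (Ideal.mem_span_singleton_self _)
  have hmem : algebraMap (MvPolynomial (Fin n) k) R
      ((∏ i, X i) * (Matrix.of fun i j => pderiv i (monomialMap k B (X j))).det) ∈
      IsLocalRing.maximalIdeal R ^ (N + 1) := by
    rw [map_mul, pow_succ']
    refine Ideal.mul_mem_mul ?_ h
    rw [← Finset.mul_prod_erase _ _ (Finset.mem_univ i), map_mul]
    exact Ideal.mul_mem_right _ _ hX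
  rw [prod_X_mul_det_pderiv, hB, Int.cast_one, one_mul, prod_monomialMap_X B i, map_mul,
    ← hN] at hmem
  have hunit : IsUnit (algebraMap (MvPolynomial (Fin n) k) R
      (∏ l ∈ Finset.univ.erase i, X l ^ (∑ j, B l j))) := by
    suffices (∏ l ∈ Finset.univ.erase i, X l ^ (∑ j, B l j) : MvPolynomial (Fin n) k) ∈
      P.primeCompl from IsLocalization.map_units R (⟨_, this⟩ : P.primeCompl)
    refine prod_mem fun l hl => pow_mem ?_ _
    intro hl'
    rw [SetLike.mem_coe, Ideal.mem_span_singleton, X_dvd_X] at hl'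
    exact Finset.ne_of_mem_erase hl hl'.symm
  have hle : P.primeCompl ≤ nonZeroDivisors _ := P.primeCompl_le_nonZeroDivisors
  have := IsLocalization.isDomain_of_le_nonZeroDivisors R hle
  rw [Ideal.mul_unit_mem_iff_mem _ hunit, map_pow, ← hmax, Ideal.map_span, Set.image_singleton,
    Ideal.span_singleton_pow, Ideal.mem_span_singleton, pow_dvd_pow_iff] at hmem
  · omega
  · exact (map_ne_zero_iff _ (IsLocalization.injective R hle)).mpr (X_ne_zero i)
  · exact hX

end LocalComputation

theorem volumeFormOrder_monomialMap_lt {k : Type u} [Field k] {n : ℕ} {R : Type u} [CommRing R]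
    [IsLocalRing R] [Algebra (MvPolynomial (Fin n) k) R] (B : Matrix (Fin n) (Fin n) ℕ)
    (hB : (B.map (Nat.cast : ℕ → ℤ)).det = 1) (i : Fin n)
    [IsLocalization.AtPrime R (Ideal.span {(MvPolynomial.X i : MvPolynomial (Fin n) k)})] :
    (volumeFormOrder ((algebraMap (MvPolynomial (Fin n) k) R).comp
      (monomialMap k B).toRingHom)).toNat < ∑ j, B i j := by
  let : Algebra k R := (((algebraMap (MvPolynomial (Fin n) k) R).comp
    (monomialMap k B).toRingHom).comp MvPolynomial.C).toAlgebra
  -- `volumeFormOrder` takes its `k`-structure through the monomial map, which fixes constants.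
  have : IsScalarTower k (MvPolynomial (Fin n) k) R := IsScalarTower.of_algebraMap_eq fun c =>
    congrArg (algebraMap _ R) ((monomialMap k B).commutes c)
  exact vanishingOrder_toNat_lt (ιMulti_monomialMap_notMem B hB i)

end LogCanonical

end

noncomputable section

namespace LogCanonical

/-! ### The toric divisor over a neighbourhood of the origin -/

section Stalks

theorem pullbackGerm_comp {R S : CommRingCat.{u}} {Y : Scheme.{u}} (g : Y ⟶ Spec S) (φ : R ⟶ S)
    (y : Y) : pullbackGerm (g ≫ Spec.map φ) y = (pullbackGerm g y).comp φ.hom := by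
  rw [pullbackGerm, pullbackGerm, ← CommRingCat.hom_comp, Scheme.Hom.comp_appTop]
  simp only [Category.assoc]
  rw [← Scheme.ΓSpecIso_inv_naturality_assoc]

/-- The stalks of an open subscheme of an affine scheme are localizations. -/
theorem isLocalization_pullbackGerm {R : CommRingCat.{u}} {Y : Scheme.{u}} (j : Y ⟶ Spec R)
    [IsOpenImmersion j] (y : Y) (x : PrimeSpectrum R) (hx : j y = x) :
    letI := (pullbackGerm j y).toAlgebra
    IsLocalization.AtPrime (Y.presheaf.stalk y) x.asIdeal := by
  subst hx
  let x : PrimeSpectrum R := j y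
  let : Algebra R (Y.presheaf.stalk y) := (pullbackGerm j y).toAlgebra
  let : Algebra R ((Spec R).presheaf.stalk (j y)) := StructureSheaf.stalkAlgebra R x
  have hloc : IsLocalization.AtPrime ((Spec R).presheaf.stalk (j y)) x.asIdeal :=
    StructureSheaf.IsLocalization.to_stalk R x
  refine IsLocalization.isLocalization_of_algEquiv x.asIdeal.primeCompl
    (AlgEquiv.ofRingEquiv (f := (asIso (j.stalkMap y)).commRingCatIsoToRingEquiv) fun r => ?_)
  have h := j.germ_stalkMap ⊤ y trivial
  have h' : CommRingCat.ofHom (pullbackGerm j y) = (Scheme.ΓSpecIso R).inv ≫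
      (Spec R).presheaf.germ ⊤ (j y) trivial ≫ j.stalkMap y := by
    rw [h]
    rfl
  exact (congrArg (fun φ => φ.hom r) h').symm

/-- A nonempty open immersion into an irreducible scheme is dominant. -/
theorem isDominant_of_isOpenImmersion {X Y : Scheme.{u}} (f : X ⟶ Y) [IsOpenImmersion f]
    [Nonempty X] [IrreducibleSpace Y] : IsDominant f :=
  ⟨f.isOpenEmbedding.isOpen_range.dense (Set.range_nonempty f)⟩

end Stalks

variable {k : Type u} [Field k] {n : ℕ}

theorem isNormalVariety_opens (V : (affineSpace k n).Opens) (hV : (V : Set (affineSpace k n)).Nonempty) :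
    IsNormalVariety k (V.ι ≫ affineSpaceToBase k n) := by
  have : Nonempty V := hV.to_subtype
  have hft : LocallyOfFiniteType (affineSpaceToBase k n) := by
    rw [affineSpaceToBase, HasRingHomProperty.Spec_iff (P := @LocallyOfFiniteType)]
    exact (RingHom.finiteType_algebraMap (A := k) (B := MvPolynomial (Fin n) k)).mpr inferInstance
  have : IsSeparated (affineSpaceToBase k n) := by
    rw [affineSpaceToBase]; infer_instance
  have : QuasiCompact (affineSpaceToBase k n) := by
    rw [affineSpaceToBase]; infer_instance
  refine ⟨inferInstance, inferInstance, inferInstance, ?_, fun y => ?_⟩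
  · infer_instance
  · let := (pullbackGerm V.ι y).toAlgebra
    have := isLocalization_pullbackGerm V.ι y _ rfl
    let x : PrimeSpectrum (MvPolynomial (Fin n) k) := V.ι y
    exact isIntegrallyClosed_of_isLocalization _ _ x.asIdeal.primeCompl_le_nonZeroDivisors

section Blowup

variable (k) (B : Matrix (Fin n) (Fin n) ℕ)

/-- The toric morphism of affine spaces given by a matrix of exponents. -/
def monomialMorphism : affineSpace k n ⟶ affineSpace k n :=
  Spec.map (CommRingCat.ofHom (monomialMap k B).toRingHom)

theorem monomialMorphism_toBase :
    monomialMorphism k B ≫ affineSpaceToBase k n = affineSpaceToBase k n := by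
  rw [monomialMorphism, affineSpaceToBase, ← Spec.map_comp, ← CommRingCat.ofHom_comp]
  congr 2
  exact (monomialMap k B).comp_algebraMap

/-- The embedding of the torus into affine space. -/
def torusEmbedding (n : ℕ) : Spec (CommRingCat.of (LaurentRing k n)) ⟶ affineSpace k n :=
  Spec.map (CommRingCat.ofHom (algebraMap (MvPolynomial (Fin n) k) (LaurentRing k n)))

instance : IsOpenImmersion (torusEmbedding k n) := by
  unfold torusEmbedding
  infer_instance

/-- The complement of the coordinate hyperplanes. -/
abbrev torus (n : ℕ) : (affineSpace k n).Opens := (torusEmbedding k n).opensRange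

theorem torus_nonempty :
    ((torus k n : (affineSpace k n).Opens) : Set (affineSpace k n)).Nonempty := by
  have : Nontrivial (LaurentRing k n) := (algebraMap_laurentRing_injective k).nontrivial
  exact Set.range_nonempty (torusEmbedding k n)

variable {B}

/-- On the torus the morphism is an automorphism followed by the inclusion. -/
theorem isOpenImmersion_torus_comp (hB : (B.map (Nat.cast : ℕ → ℤ)).det = 1) :
    IsOpenImmersion ((torus k n).ι ≫ monomialMorphism k B) := by
  have : torusEmbedding k n ≫ monomialMorphism k B =
      Spec.map (laurentEquiv k hB).toRingEquiv.toCommRingCatIso.hom ≫ torusEmbedding k n := by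
    rw [torusEmbedding, ← Spec.map_comp, monomialMorphism, ← Spec.map_comp,
      ← CommRingCat.ofHom_comp, algebraMap_comp_monomialMap k hB]
    rfl
  have : IsOpenImmersion (torusEmbedding k n ≫ monomialMorphism k B) := by
    rw [this]
    infer_instance
  have h : (torus k n).ι ≫ monomialMorphism k B =
      (torusEmbedding k n).isoOpensRange.inv ≫ (torusEmbedding k n ≫ monomialMorphism k B) := by
    simp
  rw [h]
  infer_instance

/-- The torus meets the preimage of `U` by irreducibility, and this intersection is a dense open
subscheme of the preimage that embeds as a dense open subscheme of `U`. -/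
theorem birationalOver_morphismRestrict (hB : (B.map (Nat.cast : ℕ → ℤ)).det = 1)
    (U : (affineSpace k n).Opens)
    (hV : ((monomialMorphism k B ⁻¹ᵁ U : (affineSpace k n).Opens) : Set (affineSpace k n)).Nonempty) :
    Scheme.BirationalOver (monomialMorphism k B ∣_ U) (𝟙 U.toScheme) := by
  set g := monomialMorphism k B
  set V : (affineSpace k n).Opens := g ⁻¹ᵁ U
  have : Nonempty V := hV.to_subtype
  obtain ⟨v, hv⟩ := hV
  have : Nonempty U := ⟨⟨g v, hv⟩⟩
  have := isOpenImmersion_torus_comp k hB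
  let T := V.ι ⁻¹ᵁ torus k n
  have : Nonempty T := by
    obtain ⟨z, hz, hz'⟩ := nonempty_preirreducible_inter V.2 (torus k n).2 ⟨v, hv⟩ (torus_nonempty k)
    exact ⟨⟨⟨z, hz⟩, hz'⟩⟩
  have h1 : T.ι ≫ (g ∣_ U) ≫ U.ι = (V.ι ∣_ torus k n) ≫ (torus k n).ι ≫ g := by
    rw [morphismRestrict_ι, morphismRestrict_ι_assoc]
  have h2 : IsOpenImmersion (T.ι ≫ (g ∣_ U)) := by
    have : IsOpenImmersion ((T.ι ≫ (g ∣_ U)) ≫ U.ι) := by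
      rw [Category.assoc, h1]
      infer_instance
    exact IsOpenImmersion.of_comp _ U.ι
  have : Nonempty T.toScheme := this
  have : IsDominant T.ι := isDominant_of_isOpenImmersion _
  have : IsDominant (T.ι ≫ (g ∣_ U)) := isDominant_of_isOpenImmersion _
  exact ((T.ι).birationalOver (g ∣_ U) (T.ι ≫ (g ∣_ U)) rfl).symm.trans
    ((T.ι ≫ (g ∣_ U)).birationalOver (𝟙 U.toScheme) _ (Category.comp_id _))

end Blowup

/-- The generic point of the coordinate hyperplane `x_i = 0`. -/
def hyperplanePoint (k : Type u) [Field k] {n : ℕ} (i : Fin n) : affineSpace k n :=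
  (⟨Ideal.span {(MvPolynomial.X i : MvPolynomial (Fin n) k)}, inferInstance⟩ :
    PrimeSpectrum (MvPolynomial (Fin n) k))

theorem coheight_hyperplanePoint (i : Fin n) : Order.coheight (hyperplanePoint k i) = 1 := by
  rw [← idealHeight_eq_coheight]
  exact Ideal.height_span_singleton_eq_one_of_mem_nonZeroDivisors
    (mem_nonZeroDivisors_of_ne_zero (MvPolynomial.X_ne_zero i)) MvPolynomial.X_prime.not_isUnit

/-- The image of the generic point of the hyperplane specializes to the origin, and open sets are
stable under generization. -/
theorem monomialMorphism_hyperplanePoint_mem {B : Matrix (Fin n) (Fin n) ℕ}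
    (hB : (B.map (Nat.cast : ℕ → ℤ)).det = 1) (i : Fin n) (U : (affineSpace k n).Opens)
    (hU : origin k n ∈ U) : monomialMorphism k B (hyperplanePoint k i) ∈ U := by
  refine Specializes.mem_open ?_ U.2 hU
  refine (PrimeSpectrum.le_iff_specializes _ _).mp ?_
  intro p hp
  obtain ⟨q, hq⟩ : MvPolynomial.X i ∣ monomialMap k B p := Ideal.mem_span_singleton.mp hp
  change MvPolynomial.constantCoeff p = 0
  rw [← constantCoeff_monomialMap k hB, hq]
  simp

/-- The divisor over `U` given by a coordinate hyperplane under a unimodular monomial map. -/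
def toricDivisor {B : Matrix (Fin n) (Fin n) ℕ}
    (hB : (B.map (Nat.cast : ℕ → ℤ)).det = 1) (i : Fin n) (U : (affineSpace k n).Opens)
    (hU : origin k n ∈ U) : PrimeDivisorOver k (U.ι ≫ affineSpaceToBase k n) where
  Y := (monomialMorphism k B ⁻¹ᵁ U).toScheme
  π := monomialMorphism k B ∣_ U
  isNormalVariety := by
    rw [morphismRestrict_ι_assoc, monomialMorphism_toBase]
    exact isNormalVariety_opens _ ⟨_, monomialMorphism_hyperplanePoint_mem hB i U hU⟩
  birational := birationalOver_morphismRestrict k hB U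
    ⟨_, monomialMorphism_hyperplanePoint_mem hB i U hU⟩
  genericPoint := ⟨hyperplanePoint k i, monomialMorphism_hyperplanePoint_mem hB i U hU⟩
  codim_one := by
    refine (coheight_eq_of_isOpenImmersion (monomialMorphism k B ⁻¹ᵁ U).ι).symm.trans ?_
    exact coheight_hyperplanePoint i

end LogCanonical

end

/-! ### The discrepancy inequality and the threshold -/

noncomputable section

namespace LogCanonical

variable {k : Type u} [Field k] {n : ℕ}

theorem pullbackGerm_toricDivisor {B : Matrix (Fin n) (Fin n) ℕ}
    (hB : (B.map (Nat.cast : ℕ → ℤ)).det = 1) (i : Fin n) (U : (affineSpace k n).Opens)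
    (hU : origin k n ∈ U) :
    pullbackGerm ((toricDivisor hB i U hU).π ≫ U.ι) (toricDivisor hB i U hU).genericPoint =
      (pullbackGerm (monomialMorphism k B ⁻¹ᵁ U).ι (toricDivisor hB i U hU).genericPoint).comp
        (monomialMap k B).toRingHom := by
  have h : (toricDivisor hB i U hU).π ≫ U.ι =
      (monomialMorphism k B ⁻¹ᵁ U).ι ≫ monomialMorphism k B := morphismRestrict_ι _ _
  rw [h]
  exact pullbackGerm_comp _ _ _

theorem volumeFormOrder_toricDivisor_lt {B : Matrix (Fin n) (Fin n) ℕ}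
    (hB : (B.map (Nat.cast : ℕ → ℤ)).det = 1) (i : Fin n) (U : (affineSpace k n).Opens)
    (hU : origin k n ∈ U) :
    (volumeFormOrder (pullbackGerm ((toricDivisor hB i U hU).π ≫ U.ι)
      (toricDivisor hB i U hU).genericPoint)).toNat < ∑ j, B i j := by
  rw [pullbackGerm_toricDivisor]
  set y := (toricDivisor hB i U hU).genericPoint
  set ρ := pullbackGerm (monomialMorphism k B ⁻¹ᵁ U).ι y
  let : Algebra (MvPolynomial (Fin n) k) ((toricDivisor hB i U hU).Y.presheaf.stalk y) :=
    ρ.toAlgebra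
  have : IsLocalization.AtPrime ((toricDivisor hB i U hU).Y.presheaf.stalk y)
      (Ideal.span {(MvPolynomial.X i : MvPolynomial (Fin n) k)}) :=
    isLocalization_pullbackGerm (monomialMorphism k B ⁻¹ᵁ U).ι y
      ⟨Ideal.span {MvPolynomial.X i}, inferInstance⟩ rfl
  exact volumeFormOrder_monomialMap_lt B hB i

theorem le_vanishingOrder_toricDivisor {B : Matrix (Fin n) (Fin n) ℕ}
    (hB : (B.map (Nat.cast : ℕ → ℤ)).det = 1) (i : Fin n) (U : (affineSpace k n).Opens)
    (hU : origin k n ∈ U) (d : ℕ) (f : MvPolynomial (Fin n) k) (hf : f ≠ 0)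
    (hd : ∀ m ∈ f.support, d ≤ ∑ j, m j * B i j) :
    d ≤ (vanishingOrder ((toricDivisor hB i U hU).Y.presheaf.stalk
      (toricDivisor hB i U hU).genericPoint)
      (pullbackGerm ((toricDivisor hB i U hU).π ≫ U.ι)
        (toricDivisor hB i U hU).genericPoint f)).toNat := by
  rw [pullbackGerm_toricDivisor]
  set y := (toricDivisor hB i U hU).genericPoint
  set ρ := pullbackGerm (monomialMorphism k B ⁻¹ᵁ U).ι y
  let : Algebra (MvPolynomial (Fin n) k) ((toricDivisor hB i U hU).Y.presheaf.stalk y) :=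
    ρ.toAlgebra
  have : IsLocalization.AtPrime ((toricDivisor hB i U hU).Y.presheaf.stalk y)
      (Ideal.span {(MvPolynomial.X i : MvPolynomial (Fin n) k)}) :=
    isLocalization_pullbackGerm (monomialMorphism k B ⁻¹ᵁ U).ι y
      ⟨Ideal.span {MvPolynomial.X i}, inferInstance⟩ rfl
  exact le_vanishingOrder_monomialMap B hB i d f hf hd

theorem weightedMultiplicity_le (w : Fin n → ℕ) (f : MvPolynomial (Fin n) k) {m : Fin n →₀ ℕ}
    (hm : m ∈ f.support) : weightedMultiplicity w f ≤ ∑ i, m i * w i :=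
  Nat.sInf_le ⟨m, hm, rfl⟩

theorem exists_weightedMultiplicity_eq (w : Fin n → ℕ) {f : MvPolynomial (Fin n) k} (hf : f ≠ 0) :
    ∃ m ∈ f.support, weightedMultiplicity w f = ∑ i, m i * w i :=
  Nat.sInf_mem (s := {d | ∃ m ∈ f.support, d = ∑ i, m i * w i})
    ((MvPolynomial.support_nonempty.mpr hf).elim fun m hm => ⟨_, m, hm, rfl⟩)

/-- The weighted blow-up bounds the coefficients of log canonical pairs. -/
theorem mul_weightedMultiplicity_le_of_isLogCanonicalAt {f : MvPolynomial (Fin n) k} (hf : f ≠ 0)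
    {w : Fin n → ℕ} (hw : w ≠ 0) {c : ℝ≥0} (hc : IsLogCanonicalAt (origin k n) f c) :
    c * weightedMultiplicity w f ≤ ∑ i, (w i : ℝ≥0) := by
  obtain ⟨U, hU, hlc⟩ := hc
  obtain ⟨B, i, g, hB, hg, hrow⟩ := exists_unimodular_row w hw
  have hscale (m : Fin n →₀ ℕ) : ∑ j, m j * w j = g * ∑ j, m j * B i j := by
    rw [Finset.mul_sum]
    exact Finset.sum_congr rfl fun j _ => by rw [← hrow]; ring
  obtain ⟨m₀, -, hm₀⟩ := exists_weightedMultiplicity_eq w hf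
  rw [hscale] at hm₀
  -- The least weight of `f` for row `i` of `B`, so that `w(f) = g * d`.
  set d := ∑ j, m₀ j * B i j
  have hd : ∀ m ∈ f.support, d ≤ ∑ j, m j * B i j := fun m hm => by
    have := weightedMultiplicity_le w f hm
    rw [hm₀, hscale] at this
    exact Nat.le_of_mul_le_mul_left this hg
  have hdisc := hlc (toricDivisor hB i U hU)
  have hvol := volumeFormOrder_toricDivisor_lt hB i U hU
  have hord := le_vanishingOrder_toricDivisor hB i U hU d f hf hd
  rw [discrepancy] at hdisc
  -- The strict bound supplies the `1` that cancels the `-1` in the log canonical condition.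
  rw [← Nat.add_one_le_iff, ← Nat.cast_le (α := ℝ), Nat.cast_add_one] at hvol
  have hcd : (c : ℝ) * d ≤ ((∑ j, B i j : ℕ) : ℝ) := by
    have := mul_le_mul_of_nonneg_left ((Nat.cast_le (α := ℝ)).mpr hord) c.coe_nonneg
    linarith
  have hcd' : c * d ≤ ((∑ j, B i j : ℕ) : ℝ≥0) := by exact_mod_cast hcd
  calc c * (weightedMultiplicity w f : ℝ≥0) = g * (c * d) := by rw [hm₀]; push_cast; ring
    _ ≤ g * ((∑ j, B i j : ℕ) : ℝ≥0) := by gcongr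
    _ = ∑ i, (w i : ℝ≥0) := by
      rw [Nat.cast_sum, Finset.mul_sum]
      exact Finset.sum_congr rfl fun j _ => by rw [← hrow]; push_cast; rfl

end LogCanonical

end

theorem proposition4p7 {k : Type u} [Field k] [IsAlgClosed k] {n : ℕ}
    (f : MvPolynomial (Fin n) k) (hf : f ≠ 0) (w : Fin n → ℕ) (hw : w ≠ 0) :
    1 / LogCanonical.lctAt (LogCanonical.origin k n) f ≥
      (LogCanonical.weightedMultiplicity w f : ℝ≥0∞) / (∑ i, (w i : ℝ≥0∞)) := by
  -- For `w(f) = 0` the right-hand side is `0`; otherwise dividing by `w(f)` is legitimate and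
  -- inversion reverses the bound on the threshold.
  rcases Nat.eq_zero_or_pos (LogCanonical.weightedMultiplicity w f) with h0 | hpos
  · simp [h0]
  have hM : (LogCanonical.weightedMultiplicity w f : ℝ≥0∞) ≠ 0 := by exact_mod_cast hpos.ne'
  have hlct : LogCanonical.lctAt (LogCanonical.origin k n) f ≤
      (∑ i, (w i : ℝ≥0∞)) / (LogCanonical.weightedMultiplicity w f : ℝ≥0∞) := by
    refine iSup₂_le fun c hc => ?_
    rw [ENNReal.le_div_iff_mul_le (Or.inl hM) (Or.inl (ENNReal.natCast_ne_top _))]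
    exact_mod_cast LogCanonical.mul_weightedMultiplicity_le_of_isLogCanonicalAt hf hw hc
  rw [ge_iff_le, one_div, ← ENNReal.inv_div (Or.inl (ENNReal.natCast_ne_top _)) (Or.inl hM)]
  exact ENNReal.inv_le_inv.mpr hlct
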